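/- Let $n\ge 0$ be an integer and let $\Gamma\subset\mathbb{R}^n$ be a symmetric cone containing the positive cone: $\Gamma$ is invariant under multiplication by positive scalars and under permutations of the coordinates, and it contains every vector with all entries positive. Put $-\Gamma=\{-A : A\in\Gamma\}$ and let $F:\Gamma\cup(-\Gamma)\to\mathbb{R}$ be symmetric (invariant under permutations of its arguments), odd ($F(-\kappa)=-F(\kappa)$), and non-decreasing (if $\kappa,\lambda\in\Gamma\cup(-\Gamma)$ and $\kappa_i\le\lambda_i$ for all $i$, then $F(\kappa)\le F(\lambda)$). Let $M_1,M_2$ be compact smooth $n$-dimensional manifolds without boundary, let $0<T\le\infty$, and for $i=1,2$ let $X_i:M_i\times[0,T)\to\mathbb{R}^{n+1}$ be a solution of $$\frac{\partial X}{\partial t}=-F\,\nu .$$ This means that $X_i$ and $\partial X_i/\partial t$ (one-sided at $t=0$) are continuous on $M_i\times[0,T)$, that every $X_i(\cdot,t)$ is an immersion of class $C^2$, and that at every $(x,t)$, for a choice of unit normal $\nu$ to $X_i(\cdot,t)$ at $x$, the vector $\kappa=(\kappa_1,\dots,\kappa_n)$ of principal curvatures with respect to $\nu$ lies in $\Gamma\cup(-\Gamma)$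 and $\frac{\partial X_i}{\partial t}(x,t)=-F(\kappa)\,\nu$. Here the principal curvatures are the eigenvalues, relative to the induced metric, of the second fundamental form $h(v,w)=-\langle \partial_v\partial_w X_i,\nu\rangle$ (so round spheres have positive principal curvatures with respect to the outward normal); since $F$ is odd, the equation does not depend on the choice of $\nu$. Suppose that $X_1(M_1,0)\cap X_2(M_2,0)=\emptyset$. Then the distance $$\operatorname{dist}\bigl(X_1(M_1,t),X_2(M_2,t)\bigr)=\inf\{\|X_1(x,t)-X_2(y,t)\| : x\in M_1,\ y\in M_2\}$$ is a non-decreasing function of $t\in[0,T)$, and in particular $X_1(M_1,t)\cap X_2(M_2,t)=\emptyset$ for every $t\in[0,T)$. -/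

import Mathlib

open scoped Manifold ContDiff

namespace CurvatureFlow

noncomputable section

/-- The half-open time interval `[0, T)`, where `T = ∞` is allowed. -/
def timeInterval (T : EReal) : Set ℝ := {t : ℝ | 0 ≤ t ∧ (t : EReal) < T}

/-- The distance between two subsets of Euclidean space: the infimum of the distances between
a point of the first and a point of the second. -/
def setDist {E : Type*} [PseudoMetricSpace E] (A B : Set E) : ℝ :=
  sInf (Set.image2 dist A B)

/-- A symmetric cone in `ℝⁿ` which contains the positive cone. Neither convexity nor openness is
required. -/
structure IsSymmetricCone {n : ℕ} (Γ : Set (Fin n → ℝ)) : Prop where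
  smul_mem : ∀ c : ℝ, 0 < c → ∀ κ ∈ Γ, c • κ ∈ Γ
  perm_mem : ∀ σ : Equiv.Perm (Fin n), ∀ κ ∈ Γ, κ ∘ σ ∈ Γ
  pos_mem : ∀ κ : Fin n → ℝ, (∀ i, 0 < κ i) → κ ∈ Γ

/-- `F` is an odd, non-decreasing, symmetric function on `D` (values of `F` off `D` are
irrelevant). Non-decreasing refers to the componentwise order on all of `D`. -/
structure IsOddMonotoneSymmetric {n : ℕ} (D : Set (Fin n → ℝ)) (F : (Fin n → ℝ) → ℝ) :
    Prop where
  odd : ∀ κ ∈ D, F (-κ) = -F κ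
  mono : MonotoneOn F D
  symm : ∀ σ : Equiv.Perm (Fin n), ∀ κ ∈ D, F (κ ∘ σ) = F κ

section Hypersurface

variable {n : ℕ} {M : Type*} [TopologicalSpace M] [ChartedSpace (EuclideanSpace ℝ (Fin n)) M]

/-- The map `f : M → ℝⁿ⁺¹` read in the preferred chart of `M` at `x`. -/
def localRep (f : M → EuclideanSpace ℝ (Fin (n + 1))) (x : M) :
    EuclideanSpace ℝ (Fin n) → EuclideanSpace ℝ (Fin (n + 1)) :=
  f ∘ (extChartAt (𝓡 n) x).symm

/-- The first derivative at `x` of `f` in the preferred chart at `x`. -/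
def localDeriv (f : M → EuclideanSpace ℝ (Fin (n + 1))) (x : M) :
    EuclideanSpace ℝ (Fin n) →L[ℝ] EuclideanSpace ℝ (Fin (n + 1)) :=
  fderiv ℝ (localRep f x) (extChartAt (𝓡 n) x x)

/-- The first fundamental form (induced metric) of `f` at `x`: `g(v, w) = ⟨∂ᵥf, ∂_w f⟩`. -/
def firstForm (f : M → EuclideanSpace ℝ (Fin (n + 1))) (x : M)
    (v w : EuclideanSpace ℝ (Fin n)) : ℝ :=
  inner ℝ (localDeriv f x v) (localDeriv f x w)

/-- The second fundamental form of `f` at `x` with respect to the unit normal `ν`, with the sign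
for which a sphere has positive curvature with respect to its outward normal:
`h(v, w) = -⟨∂ᵥ∂_w f, ν⟩`. -/
def secondForm (f : M → EuclideanSpace ℝ (Fin (n + 1))) (ν : EuclideanSpace ℝ (Fin (n + 1)))
    (x : M) (v w : EuclideanSpace ℝ (Fin n)) : ℝ :=
  -inner ℝ (fderiv ℝ (fderiv ℝ (localRep f x)) (extChartAt (𝓡 n) x x) v w) ν

/-- `ν` is a unit normal vector at the point `x` of the hypersurface parametrized by `f`. -/
def IsUnitNormal (f : M → EuclideanSpace ℝ (Fin (n + 1))) (x : M)
    (ν : EuclideanSpace ℝ (Fin (n + 1))) : Prop :=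
  ‖ν‖ = 1 ∧ ∀ v, inner ℝ (localDeriv f x v) ν = 0

/-- `κ` lists the principal curvatures of `f` at `x` with respect to `ν`, with multiplicity and in
some order: there is a basis of the tangent space, orthonormal for the first fundamental form,
that diagonalizes the second fundamental form with diagonal entries `κ`. -/
def IsPrincipalCurvatures (f : M → EuclideanSpace ℝ (Fin (n + 1)))
    (ν : EuclideanSpace ℝ (Fin (n + 1))) (x : M) (κ : Fin n → ℝ) : Prop :=
  ∃ e : Module.Basis (Fin n) ℝ (EuclideanSpace ℝ (Fin n)),
    (∀ i j, firstForm f x (e i) (e j) = if i = j then 1 else 0) ∧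
    (∀ i j, secondForm f ν x (e i) (e j) = if i = j then κ i else 0)

/-- `X : M × [0, T) → ℝⁿ⁺¹` is a classical solution of `∂X/∂t = -F ν`, where `F` is evaluated at
the principal curvatures, which are required to lie in `D`, the domain of `F`.
Each `X(·, t)` is an immersion (not necessarily injective) of class `C²`, and `∂X/∂t` (one-sided
at `t = 0`) is continuous on `M × [0, T)`; in particular all `C^∞` solutions are covered.
`ν(x, t)` is a choice of unit normal at each point. As `F` is odd in the application, the equation
is unaffected by changing the sign of `ν` at any point, so no continuity of `ν` (that is, no
orientability of `M`) is demanded. -/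
structure IsSolution (D : Set (Fin n → ℝ)) (F : (Fin n → ℝ) → ℝ) (T : EReal)
    (X : M → ℝ → EuclideanSpace ℝ (Fin (n + 1)))
    (ν : M → ℝ → EuclideanSpace ℝ (Fin (n + 1))) : Prop where
  contMDiff : ∀ t ∈ timeInterval T,
    ContMDiff (𝓡 n) 𝓘(ℝ, EuclideanSpace ℝ (Fin (n + 1))) 2 (fun x => X x t)
  immersion : ∀ t ∈ timeInterval T, ∀ x : M,
    Function.Injective (mfderiv (𝓡 n) 𝓘(ℝ, EuclideanSpace ℝ (Fin (n + 1))) (fun y => X y t) x)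
  continuousOn : ContinuousOn (fun p : M × ℝ => X p.1 p.2) (Set.univ ×ˢ timeInterval T)
  continuousOn_velocity :
    ContinuousOn (fun p : M × ℝ => derivWithin (X p.1) (timeInterval T) p.2)
      (Set.univ ×ˢ timeInterval T)
  isUnitNormal : ∀ t ∈ timeInterval T, ∀ x : M, IsUnitNormal (fun y => X y t) x (ν x t)
  flow : ∀ t ∈ timeInterval T, ∀ x : M, ∃ κ ∈ D,
    IsPrincipalCurvatures (fun y => X y t) (ν x t) x κ ∧
    HasDerivWithinAt (X x) (-(F κ • ν x t)) (timeInterval T) t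

end Hypersurface

end

end CurvatureFlow

/-! Maximum principle on the product `M₁ × M₂`, applied to the squared distance, which stays
differentiable where the two points coincide. It suffices that its time derivative is nonnegative at
each spatial minimum (`exists_le_of_deriv_nonneg_at_min`).

At a closest pair at distance r > 0, let u be the unit vector from the first point to the second.
The first variation makes u normal to both hypersurfaces. Moving both points by the same tangent
vector cancels the gradient term of the second variation, leaving h₁ ≥ h₂ for the second fundamental
forms relative to u on the common tangent space. By Weyl's principle (`eigenvalues_le_of_form_le`)
the sorted curvatures satisfy κ ≥ μ, so symmetry and monotonicity give F(κ) ≥ F(μ). The velocities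
are -F(κ)u and -F(μ)u, by oddness whatever normals were chosen, so the squared distance has
derivative 2r(F(κ) - F(μ)) ≥ 0. At a coincident pair the derivative is zero.

Neither continuity of F nor convexity of its domain enters: F is only compared at two vectors. -/

namespace CurvatureFlow

open Set Filter Topology

/-! ### Maximum principle on a compact space -/

/-- If the time derivative of `q` is nonnegative at each spatial minimum, then the spatial minimum
of `q` does not decrease. -/
theorem exists_le_of_deriv_nonneg_at_min {K : Type*} [TopologicalSpace K] [CompactSpace K]
    {q q' : K → ℝ → ℝ} {a b : ℝ} (hab : a ≤ b)
    (hq : ContinuousOn (fun p : K × ℝ => q p.1 p.2) (univ ×ˢ Icc a b))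
    (hq' : ContinuousOn (fun p : K × ℝ => q' p.1 p.2) (univ ×ˢ Icc a b))
    (hd : ∀ p, ∀ t ∈ Icc a b, HasDerivWithinAt (q p) (q' p t) (Icc a b) t)
    (hmin : ∀ t ∈ Icc a b, ∀ p, (∀ p', q p t ≤ q p' t) → 0 ≤ q' p t) (p : K) :
    ∃ p', q p' a ≤ q p b := by
  have : Nonempty K := ⟨p⟩
  let m : ℝ → ℝ := fun t => sInf ((fun p => q p t) '' univ)
  have hqt : ∀ t ∈ Icc a b, Continuous fun p => q p t := fun t ht =>
    hq.comp_continuous (by fun_prop : Continuous fun p : K => (p, t)) fun p => ⟨mem_univ _, ht⟩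
  have hatt : ∀ t ∈ Icc a b, ∃ p, q p t = m t ∧ ∀ p', q p t ≤ q p' t := by
    intro t ht
    obtain ⟨p, -, hp, hp'⟩ := isCompact_univ.exists_sInf_image_eq_and_le univ_nonempty
      (hqt t ht).continuousOn
    exact ⟨p, hp.symm, fun p' => hp' p' (mem_univ _)⟩
  have hmle : ∀ t ∈ Icc a b, ∀ p', m t ≤ q p' t := by
    intro t ht p'
    obtain ⟨p, hp, hp'⟩ := hatt t ht
    exact hp ▸ hp' p'
  have hmc : ContinuousOn m (Icc a b) := by
    rw [continuousOn_iff_continuous_domRestrict]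
    refine IsCompact.continuous_sInf (f := fun (t : Icc a b) p => q p t) isCompact_univ ?_
    exact hq.comp_continuous (by fun_prop : Continuous fun z : Icc a b × K => (z.2, (z.1 : ℝ)))
      fun z => ⟨mem_univ _, z.1.2⟩
  -- -m has lower right Dini derivative at most 0, which already forces it not to increase.
  have key : ∀ t ∈ Ico a b, ∀ r : ℝ, 0 < r → ∃ᶠ z in 𝓝[>] t, slope (fun s => -m s) t z < r := by
    intro t ht r hr
    have htI : t ∈ Icc a b := Ico_subset_Icc_self ht
    -- The slack r/2 keeps the final slope strictly below r. Compactness reduces the bound to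
    -- neighbourhoods of single points: near a minimizer the derivative exceeds -r/2 and the mean
    -- value inequality applies; elsewhere the strict gap above m t persists by continuity.
    have hev : ∀ᶠ z in 𝓝 t, ∀ p ∈ (univ : Set K), z ∈ Icc t b →
        m t - r / 2 * (z - t) ≤ q p z := by
      refine isCompact_univ.eventually_forall_of_forall_eventually fun p₀ _ => ?_
      by_cases hp₀ : q p₀ t = m t
      · have h0 : -(r / 2) < q' p₀ t :=
          lt_of_lt_of_le (by linarith) (hmin t htI p₀ fun p' => hp₀ ▸ hmle t htI p')
        have h1 := (hq' (p₀, t) ⟨mem_univ _, htI⟩).eventually (lt_mem_nhds h0)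
        rw [eventually_nhdsWithin_iff, nhds_prod_eq, eventually_prod_iff] at h1
        obtain ⟨A, hA, B, hB, hAB⟩ := h1
        obtain ⟨δ, hδ, hBδ⟩ := Metric.eventually_nhds_iff.1 hB
        rw [nhds_prod_eq, eventually_prod_iff]
        refine ⟨fun z => dist z t < δ, Metric.eventually_nhds_iff.2 ⟨δ, hδ, fun _ h => h⟩, A, hA,
          ?_⟩
        intro z hz p hp hzt
        have hsub : Icc t z ⊆ Icc a b := Icc_subset_Icc ht.1 hzt.2
        have hder : ∀ s ∈ interior (Icc t z), HasDerivAt (q p) (q' p s) s := by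
          intro s hs
          have hs' : Icc a b ∈ 𝓝 s :=
            mem_of_superset (mem_interior_iff_mem_nhds.1 hs) hsub
          exact (hd p s (hsub (interior_subset hs))).hasDerivAt hs'
        have := (convex_Icc t z).mul_sub_le_image_sub_of_le_deriv (f := q p) (C := -(r / 2))
          (fun s hs => ((hd p s (hsub hs)).continuousWithinAt).mono hsub)
          (fun s hs => (hder s hs).differentiableAt.differentiableWithinAt)
          (fun s hs => by
            rw [(hder s hs).deriv]
            have hs' := interior_subset hs
            refine (hAB hp (hBδ (y := s) ?_) ⟨mem_univ _, hsub hs'⟩).le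
            rw [Real.dist_eq, abs_of_nonneg (by linarith [hs'.1])]
            rw [Real.dist_eq, abs_of_nonneg (by linarith [hzt.1])] at hz
            linarith [hs'.2])
          t (left_mem_Icc.2 hzt.1) z (right_mem_Icc.2 hzt.1) hzt.1
        have := hmle t htI p
        linarith
      · have h0 : m t < q p₀ t := lt_of_le_of_ne (hmle t htI p₀) (Ne.symm hp₀)
        have h1 := (hq (p₀, t) ⟨mem_univ _, htI⟩).eventually (lt_mem_nhds h0)
        rw [eventually_nhdsWithin_iff] at h1
        have h2 := (continuous_swap.tendsto (t, p₀)).eventually h1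
        filter_upwards [h2] with z hz hzt
        have h3 : m t < q z.2 z.1 := hz ⟨mem_univ _, ht.1.trans hzt.1, hzt.2⟩
        have h4 : 0 ≤ r / 2 * (z.1 - t) := mul_nonneg (by linarith) (by linarith [hzt.1])
        linarith
    refine Eventually.frequently ?_
    filter_upwards [nhdsWithin_le_nhds hev, Ioo_mem_nhdsGT ht.2] with z hz hzt
    obtain ⟨p, hp, -⟩ := hatt z ⟨ht.1.trans hzt.1.le, hzt.2.le⟩
    have := hz p (mem_univ _) ⟨hzt.1.le, hzt.2.le⟩
    have hpos : 0 < z - t := sub_pos.2 hzt.1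
    rw [slope_def_field, div_lt_iff₀ hpos]
    nlinarith
  have hfin := image_le_of_liminf_slope_right_le_deriv_boundary (f := fun s => -m s)
    (B := fun _ => -m a) (B' := fun _ => 0) hmc.neg le_rfl continuousOn_const
    (fun x _ => hasDerivWithinAt_const _ _ _) key (right_mem_Icc.2 hab)
  obtain ⟨p', hp', -⟩ := hatt a (left_mem_Icc.2 hab)
  refine ⟨p', ?_⟩
  have := hmle b (right_mem_Icc.2 hab) p
  exact (neg_le_neg_iff.1 hfin).trans' hp'.le |>.trans this

/-! ### Comparison of eigenvalues -/

/-- Weyl's monotonicity principle: if one quadratic form dominates another, then its ordered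
eigenvalues dominate as well. The forms are given by their diagonalizations. -/
theorem eigenvalues_le_of_form_le {V : Type*} [NormedAddCommGroup V] [InnerProductSpace ℝ V]
    [FiniteDimensional ℝ V] {n : ℕ} (hV : Module.finrank ℝ V ≤ n) {a b : Fin n → V}
    (ha : Orthonormal ℝ a) (hb : Orthonormal ℝ b) {κ μ : Fin n → ℝ}
    (hκ : Monotone κ) (hμ : Monotone μ)
    (h : ∀ c d : Fin n → ℝ, ∑ i, c i • a i = ∑ i, d i • b i →
      ∑ i, μ i * d i ^ 2 ≤ ∑ i, κ i * c i ^ 2) : μ ≤ κ := by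
  intro k
  -- The kernel consists of two expansions of one vector, c supported on i ≤ k and d on i ≥ k. There
  -- are 2n unknowns and at most n + (n - 1 - k) + k = 2n - 1 equations, so a nonzero solution
  -- exists. On it, μ k and κ k bound the two forms from below and above.
  let φ : (Fin n → ℝ) × (Fin n → ℝ) →ₗ[ℝ] V × ({i // k < i} → ℝ) × ({i // i < k} → ℝ) :=
    ((Fintype.linearCombination ℝ a).comp (LinearMap.fst ℝ _ _) -
      (Fintype.linearCombination ℝ b).comp (LinearMap.snd ℝ _ _)).prod
    (((LinearMap.funLeft ℝ ℝ Subtype.val).comp (LinearMap.fst ℝ _ _)).prod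
      ((LinearMap.funLeft ℝ ℝ Subtype.val).comp (LinearMap.snd ℝ _ _)))
  have hker : LinearMap.ker φ ≠ ⊥ := by
    apply LinearMap.ker_ne_bot_of_finrank_lt
    have h1 : Fintype.card {i // k < i} = n - 1 - k := by
      rw [Fintype.card_subtype, Finset.filter_lt_eq_Ioi, Fin.card_Ioi]
    have h2 : Fintype.card {i // i < k} = k := by
      rw [Fintype.card_subtype, Finset.filter_gt_eq_Iio, Fin.card_Iio]
    simp only [Module.finrank_prod, Module.finrank_fintype_fun_eq_card, h1, h2, Fintype.card_fin]
    have := k.2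
    omega
  obtain ⟨⟨c, d⟩, hmem, hne⟩ := Submodule.exists_mem_ne_zero_of_ne_bot hker
  have hmem' : φ (c, d) = 0 := hmem
  simp only [φ, LinearMap.prod_apply, Function.prod, LinearMap.sub_apply, LinearMap.comp_apply,
    LinearMap.fst_apply, LinearMap.snd_apply, Fintype.linearCombination_apply, Prod.mk_eq_zero,
    sub_eq_zero] at hmem'
  obtain ⟨hsum, hc, hd⟩ := hmem'
  have hc' : ∀ i, k < i → c i = 0 := fun i hi => congrFun hc ⟨i, hi⟩
  have hd' : ∀ i, i < k → d i = 0 := fun i hi => congrFun hd ⟨i, hi⟩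
  have hnorm : ∑ i, c i ^ 2 = ∑ i, d i ^ 2 := by
    have h1 := ha.inner_sum c c Finset.univ
    have h2 := hb.inner_sum d d Finset.univ
    rw [hsum, h2] at h1
    simpa [sq] using h1.symm
  have hpos : 0 < ∑ i, c i ^ 2 := by
    refine lt_of_le_of_ne (Finset.sum_nonneg fun i _ => sq_nonneg _) fun h0 => hne ?_
    have h0' : ∑ i, d i ^ 2 = 0 := by rw [← hnorm, ← h0]
    have e1 := (Finset.sum_eq_zero_iff_of_nonneg fun i _ => sq_nonneg (c i)).1 h0.symm
    have e2 := (Finset.sum_eq_zero_iff_of_nonneg fun i _ => sq_nonneg (d i)).1 h0'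
    ext i
    · simpa using e1 i
    · simpa using e2 i
  have l1 : μ k * ∑ i, d i ^ 2 ≤ ∑ i, μ i * d i ^ 2 := by
    rw [Finset.mul_sum]
    refine Finset.sum_le_sum fun i _ => ?_
    rcases lt_or_ge i k with hi | hi
    · simp [hd' i hi]
    · exact mul_le_mul_of_nonneg_right (hμ hi) (sq_nonneg _)
  have l2 : ∑ i, κ i * c i ^ 2 ≤ κ k * ∑ i, c i ^ 2 := by
    rw [Finset.mul_sum]
    refine Finset.sum_le_sum fun i _ => ?_
    rcases lt_or_ge k i with hi | hi
    · simp [hc' i hi]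
    · exact mul_le_mul_of_nonneg_right (hκ hi) (sq_nonneg _)
  have := h c d hsum
  rw [← hnorm] at l1
  exact le_of_mul_le_mul_right (l1.trans (this.trans l2)) hpos

/-! ### Second variation along lines -/

/-- The second-order necessary condition for a local minimum in one variable. -/
theorem deriv_deriv_nonneg_of_isLocalMin {g : ℝ → ℝ} {x : ℝ} (h : IsLocalMin g x)
    (hc : ContinuousAt g x) : 0 ≤ deriv (deriv g) x := by
  by_contra! hneg
  -- A negative second derivative would make x a local maximum too, so g would be locally constant.
  have hmax := isLocalMax_of_deriv_deriv_neg hneg h.deriv_eq_zero hc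
  have heq : g =ᶠ[𝓝 x] fun _ => g x := by
    filter_upwards [h, hmax] with y h1 h2 using le_antisymm h2 h1
  have := heq.deriv.deriv_eq
  simp at this
  exact hneg.ne this

/-- First and second variation of the squared norm along a curve through a local minimum. -/
theorem variation_normSq_of_isLocalMin {E : Type*} [NormedAddCommGroup E] [InnerProductSpace ℝ E]
    {G G' : ℝ → E} {G'' : E} (hG : ∀ᶠ s in 𝓝 0, HasDerivAt G (G' s) s)
    (hG' : HasDerivAt G' G'' 0) (hmin : IsLocalMin (fun s => ‖G s‖ ^ 2) 0) :
    inner ℝ (G 0) (G' 0) = 0 ∧ 0 ≤ ‖G' 0‖ ^ 2 + inner ℝ (G 0) G'' := by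
  have h1 : ∀ᶠ s in 𝓝 0, HasDerivAt (fun s => ‖G s‖ ^ 2) (2 * inner ℝ (G s) (G' s)) s := by
    filter_upwards [hG] with s hs using hs.norm_sq
  have h2 : deriv (fun s => ‖G s‖ ^ 2) =ᶠ[𝓝 0] fun s => 2 * inner ℝ (G s) (G' s) := by
    filter_upwards [h1] with s hs using hs.deriv
  have h3 : HasDerivAt (fun s => 2 * inner ℝ (G s) (G' s))
      (2 * (inner ℝ (G 0) G'' + inner ℝ (G' 0) (G' 0))) 0 :=
    (hG.self_of_nhds.inner ℝ hG').const_mul 2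
  have h4 := deriv_deriv_nonneg_of_isLocalMin hmin h1.self_of_nhds.continuousAt
  have h5 := hmin.deriv_eq_zero
  rw [h2.deriv_eq, h3.deriv, real_inner_self_eq_norm_sq] at h4
  rw [h1.self_of_nhds.deriv] at h5
  constructor <;> linarith

/-- First and second derivative of a `C²` map along an affine line. -/
theorem hasDerivAt_along_line {V E : Type*} [NormedAddCommGroup V] [NormedSpace ℝ V]
    [NormedAddCommGroup E] [NormedSpace ℝ E] {f : V → E} {p : V} (hf : ContDiffAt ℝ 2 f p) (v : V) :
    (∀ᶠ s in 𝓝 (0 : ℝ), HasDerivAt (fun s : ℝ => f (p + s • v)) (fderiv ℝ f (p + s • v) v) s) ∧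
    HasDerivAt (fun s : ℝ => fderiv ℝ f (p + s • v) v) (fderiv ℝ (fderiv ℝ f) p v v) 0 := by
  have hl : ∀ s : ℝ, HasDerivAt (fun s : ℝ => p + s • v) v s := fun s => by
    simpa using ((hasDerivAt_id s).smul_const v).const_add p
  have h0 : p + (0 : ℝ) • v = p := by simp
  constructor
  · have hev : ∀ᶠ y in 𝓝 p, DifferentiableAt ℝ f y := by
      filter_upwards [hf.eventually (by simp)] with y hy
      exact hy.differentiableAt (by simp)
    have ht : Tendsto (fun s : ℝ => p + s • v) (𝓝 0) (𝓝 p) := by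
      simpa [h0] using (hl 0).continuousAt.tendsto
    filter_upwards [ht.eventually hev] with s hs
    exact hs.hasFDerivAt.comp_hasDerivAt s (hl s)
  · have hd : DifferentiableAt ℝ (fderiv ℝ f) (p + (0 : ℝ) • v) := by
      rw [h0]
      exact (hf.fderiv_right (m := 1) (by norm_num)).differentiableAt (by simp)
    have h1 := hd.hasFDerivAt.comp_hasDerivAt (0 : ℝ) (hl 0)
    have h2 := h1.clm_apply (hasDerivAt_const (0 : ℝ) v)
    simpa [h0] using h2

/-! ### Charts, unit normals and the choice of sign -/

section Hypersurface

variable {n : ℕ} {M : Type*} [TopologicalSpace M] [ChartedSpace (EuclideanSpace ℝ (Fin n)) M]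

theorem contDiffAt_localRep [IsManifold (𝓡 n) ∞ M] {f : M → EuclideanSpace ℝ (Fin (n + 1))}
    (hf : ContMDiff (𝓡 n) 𝓘(ℝ, EuclideanSpace ℝ (Fin (n + 1))) 2 f) (x : M) :
    ContDiffAt ℝ 2 (localRep f x) (extChartAt (𝓡 n) x x) := by
  have : IsManifold (𝓡 n) 2 M := IsManifold.of_le (n := ∞) ENat.LEInfty.out
  have h := hf.comp_contMDiffOn (contMDiffOn_extChartAt_symm (I := 𝓡 n) (n := 2) x)
  rw [contMDiffOn_iff_contDiffOn] at h
  exact h.contDiffAt (extChartAt_target_mem_nhds x)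

theorem localRep_extChartAt (f : M → EuclideanSpace ℝ (Fin (n + 1))) (x : M) :
    localRep f x (extChartAt (𝓡 n) x x) = f x := by
  simp [localRep]

theorem orthonormal_localDeriv {f : M → EuclideanSpace ℝ (Fin (n + 1))} {x : M}
    {e : Fin n → EuclideanSpace ℝ (Fin n)}
    (he : ∀ i j, firstForm f x (e i) (e j) = if i = j then 1 else 0) :
    Orthonormal ℝ fun i => localDeriv f x (e i) :=
  orthonormal_iff_ite.2 he

theorem IsPrincipalCurvatures.neg {f : M → EuclideanSpace ℝ (Fin (n + 1))} {x : M}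
    {ν : EuclideanSpace ℝ (Fin (n + 1))} {κ : Fin n → ℝ} (h : IsPrincipalCurvatures f ν x κ) :
    IsPrincipalCurvatures f (-ν) x (-κ) := by
  obtain ⟨e, he, hκ⟩ := h
  refine ⟨e, he, fun i j => ?_⟩
  have := hκ i j
  simp only [secondForm, inner_neg_right, Pi.neg_apply] at this ⊢
  rw [this]
  split_ifs <;> simp

/-- A hypersurface has only two unit normals at each point. -/
theorem IsUnitNormal.eq_or_eq_neg {f : M → EuclideanSpace ℝ (Fin (n + 1))} {x : M}
    {ν u : EuclideanSpace ℝ (Fin (n + 1))} {e : Fin n → EuclideanSpace ℝ (Fin n)}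
    (he : ∀ i j, firstForm f x (e i) (e j) = if i = j then 1 else 0)
    (hν : IsUnitNormal f x ν) (hu : IsUnitNormal f x u) : u = ν ∨ u = -ν := by
  let S := Submodule.span ℝ (range fun i => localDeriv f x (e i))
  have hS : Module.finrank ℝ S = n := by
    simpa using finrank_span_eq_card (orthonormal_localDeriv he).linearIndependent
  -- The tangent space has dimension n in ℝⁿ⁺¹, so the normal space is a line.
  have hS' : Module.finrank ℝ Sᗮ = 1 := by
    have := S.finrank_add_finrank_orthogonal
    rw [hS, finrank_euclideanSpace_fin] at this
    omega
  have hmem : ∀ w, IsUnitNormal f x w → w ∈ Sᗮ := by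
    intro w hw
    rw [Submodule.mem_orthogonal]
    intro z hz
    induction hz using Submodule.span_induction with
    | mem z hz => obtain ⟨i, rfl⟩ := hz; exact hw.2 _
    | zero => simp
    | add y z _ _ hy hz => rw [inner_add_left, hy, hz, add_zero]
    | smul c z _ hz => rw [inner_smul_left, hz, mul_zero]
  have hne : (⟨ν, hmem ν hν⟩ : Sᗮ) ≠ 0 := by
    intro h
    have h' : ν = 0 := congrArg Subtype.val h
    have := hν.1
    simp [h'] at this
  obtain ⟨c, hc⟩ := (finrank_eq_one_iff_of_nonzero' _ hne).1 hS' ⟨u, hmem u hu⟩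
  have hc' : c • ν = u := congrArg Subtype.val hc
  have habs : |c| = 1 := by
    have := hu.1
    rwa [← hc', norm_smul, hν.1, mul_one, Real.norm_eq_abs] at this
  rcases eq_or_eq_neg_of_abs_eq habs with rfl | rfl
  · left; simpa using hc'.symm
  · right; simpa using hc'.symm

/-- Since `F` is odd, the flow equation may be read off with either unit normal. -/
theorem IsSolution.exists_curvatures {D : Set (Fin n → ℝ)} {F : (Fin n → ℝ) → ℝ} {T : EReal}
    {X ν : M → ℝ → EuclideanSpace ℝ (Fin (n + 1))} (hX : IsSolution D F T X ν)
    (hD : ∀ κ ∈ D, -κ ∈ D) (hodd : ∀ κ ∈ D, F (-κ) = -F κ) {t : ℝ} (ht : t ∈ timeInterval T)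
    {x : M} {u : EuclideanSpace ℝ (Fin (n + 1))} (hu : IsUnitNormal (fun y => X y t) x u) :
    ∃ κ ∈ D, IsPrincipalCurvatures (fun y => X y t) u x κ ∧
      HasDerivWithinAt (X x) (-(F κ • u)) (timeInterval T) t := by
  obtain ⟨κ, hκD, hκ, hder⟩ := hX.flow t ht x
  obtain ⟨e, he, -⟩ := id hκ
  rcases (hX.isUnitNormal t ht x).eq_or_eq_neg he hu with rfl | rfl
  · exact ⟨κ, hκD, hκ, hder⟩
  · refine ⟨-κ, hD κ hκD, hκ.neg, ?_⟩
    rwa [hodd κ hκD, neg_smul_neg]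

end Hypersurface

theorem secondForm_sum {n : ℕ} {M : Type*} [TopologicalSpace M]
    [ChartedSpace (EuclideanSpace ℝ (Fin n)) M] {f : M → EuclideanSpace ℝ (Fin (n + 1))}
    {ν : EuclideanSpace ℝ (Fin (n + 1))} {x : M} {κ : Fin n → ℝ}
    {e : Fin n → EuclideanSpace ℝ (Fin n)}
    (he : ∀ i j, secondForm f ν x (e i) (e j) = if i = j then κ i else 0) (c : Fin n → ℝ) :
    secondForm f ν x (∑ i, c i • e i) (∑ i, c i • e i) = ∑ i, κ i * c i ^ 2 := by
  have h : secondForm f ν x (∑ i, c i • e i) (∑ i, c i • e i) =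
      ∑ i, ∑ j, c i * c j * secondForm f ν x (e i) (e j) := by
    simp only [secondForm, map_sum, map_smul, sum_apply,
      smul_apply, sum_inner, real_inner_smul_left, Finset.smul_sum,
      mul_neg, Finset.sum_neg_distrib]
    rw [Finset.sum_comm]
    simp only [mul_assoc]
    congr 1
    refine Finset.sum_congr rfl fun i _ => Finset.sum_congr rfl fun j _ => by ring
  rw [h]
  refine Finset.sum_congr rfl fun i _ => ?_
  simp only [he, mul_ite, mul_zero, Finset.sum_ite_eq, Finset.mem_univ, if_true]
  ring

/-! ### Geometry at a closest pair -/

section TwoHypersurfaces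

variable {n : ℕ} {M₁ M₂ : Type*}
  [TopologicalSpace M₁] [ChartedSpace (EuclideanSpace ℝ (Fin n)) M₁]
  [TopologicalSpace M₂] [ChartedSpace (EuclideanSpace ℝ (Fin n)) M₂]

/-- First and second variation of the squared distance at a closest pair of points of two
hypersurfaces. -/
theorem variation_of_closest [IsManifold (𝓡 n) ∞ M₁] [IsManifold (𝓡 n) ∞ M₂]
    {f₁ : M₁ → EuclideanSpace ℝ (Fin (n + 1))} {f₂ : M₂ → EuclideanSpace ℝ (Fin (n + 1))}
    (hf₁ : ContMDiff (𝓡 n) 𝓘(ℝ, EuclideanSpace ℝ (Fin (n + 1))) 2 f₁)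
    (hf₂ : ContMDiff (𝓡 n) 𝓘(ℝ, EuclideanSpace ℝ (Fin (n + 1))) 2 f₂) {x : M₁} {y : M₂}
    (hmin : ∀ x' y', ‖f₁ x - f₂ y‖ ^ 2 ≤ ‖f₁ x' - f₂ y'‖ ^ 2)
    (v w : EuclideanSpace ℝ (Fin n)) :
    inner ℝ (f₁ x - f₂ y) (localDeriv f₁ x v - localDeriv f₂ y w) = 0 ∧
    0 ≤ ‖localDeriv f₁ x v - localDeriv f₂ y w‖ ^ 2 + inner ℝ (f₁ x - f₂ y)
      (fderiv ℝ (fderiv ℝ (localRep f₁ x)) (extChartAt (𝓡 n) x x) v v -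
        fderiv ℝ (fderiv ℝ (localRep f₂ y)) (extChartAt (𝓡 n) y y) w w) := by
  obtain ⟨h1, h1'⟩ := hasDerivAt_along_line (contDiffAt_localRep hf₁ x) v
  obtain ⟨h2, h2'⟩ := hasDerivAt_along_line (contDiffAt_localRep hf₂ y) w
  have h := variation_normSq_of_isLocalMin
    (G := fun s => localRep f₁ x (extChartAt (𝓡 n) x x + s • v) -
      localRep f₂ y (extChartAt (𝓡 n) y y + s • w))
    (by filter_upwards [h1, h2] with s hs1 hs2 using hs1.sub hs2) (h1'.sub h2')
    (Eventually.of_forall fun s => by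
      simp only [zero_smul, add_zero, localRep_extChartAt]
      exact hmin _ _)
  simpa only [Pi.sub_apply, zero_smul, add_zero, localRep_extChartAt, localDeriv] using h

/-- At a closest pair of points of two hypersurfaces, the ordered principal curvatures of the
hypersurface that the common normal `u` points away from are at least those of the other one. -/
theorem sorted_curvatures_le_of_closest [IsManifold (𝓡 n) ∞ M₁] [IsManifold (𝓡 n) ∞ M₂]
    {f₁ : M₁ → EuclideanSpace ℝ (Fin (n + 1))} {f₂ : M₂ → EuclideanSpace ℝ (Fin (n + 1))}
    (hf₁ : ContMDiff (𝓡 n) 𝓘(ℝ, EuclideanSpace ℝ (Fin (n + 1))) 2 f₁)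
    (hf₂ : ContMDiff (𝓡 n) 𝓘(ℝ, EuclideanSpace ℝ (Fin (n + 1))) 2 f₂) {x : M₁} {y : M₂}
    (hmin : ∀ x' y', ‖f₁ x - f₂ y‖ ^ 2 ≤ ‖f₁ x' - f₂ y'‖ ^ 2)
    {u : EuclideanSpace ℝ (Fin (n + 1))} {r : ℝ} (hr : 0 < r) (hru : f₁ x - f₂ y = -(r • u))
    (hu₁ : IsUnitNormal f₁ x u) (hu₂ : IsUnitNormal f₂ y u) {κ μ : Fin n → ℝ}
    (hκ : IsPrincipalCurvatures f₁ u x κ) (hμ : IsPrincipalCurvatures f₂ u y μ) :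
    μ ∘ Tuple.sort μ ≤ κ ∘ Tuple.sort κ := by
  obtain ⟨e, he, heκ⟩ := hκ
  obtain ⟨e', he', heμ⟩ := hμ
  set σ := Tuple.sort κ
  set τ := Tuple.sort μ
  -- Both tangent spaces lie in the n-dimensional complement of u, where the two orthonormal frames
  -- can be compared.
  have hmem₁ : ∀ v, localDeriv f₁ x v ∈ (Submodule.span ℝ {u})ᗮ := fun v =>
    Submodule.mem_orthogonal_singleton_iff_inner_left.2 (hu₁.2 v)
  have hmem₂ : ∀ v, localDeriv f₂ y v ∈ (Submodule.span ℝ {u})ᗮ := fun v =>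
    Submodule.mem_orthogonal_singleton_iff_inner_left.2 (hu₂.2 v)
  have hu0 : u ≠ 0 := fun h => by simpa [h] using hu₁.1
  have hfin : Module.finrank ℝ (Submodule.span ℝ {u})ᗮ ≤ n := by
    have := (Submodule.span ℝ {u}).finrank_add_finrank_orthogonal
    rw [finrank_span_singleton hu0, finrank_euclideanSpace_fin] at this
    omega
  refine eigenvalues_le_of_form_le hfin
    (a := fun i => ⟨localDeriv f₁ x (e (σ i)), hmem₁ _⟩)
    (b := fun i => ⟨localDeriv f₂ y (e' (τ i)), hmem₂ _⟩)
    (orthonormal_iff_ite.2 fun i j => ?_) (orthonormal_iff_ite.2 fun i j => ?_)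
    (Tuple.monotone_sort κ) (Tuple.monotone_sort μ) fun c d hcd => ?_
  · simpa [firstForm] using he (σ i) (σ j)
  · simpa [firstForm] using he' (τ i) (τ j)
  -- Equal first-order displacements: the squared-norm term of the second variation vanishes.
  · have hcd' : localDeriv f₁ x (∑ i, c i • e (σ i)) = localDeriv f₂ y (∑ i, d i • e' (τ i)) := by
      have := congrArg Subtype.val hcd
      simpa using this
    have h := (variation_of_closest hf₁ hf₂ hmin (∑ i, c i • e (σ i)) (∑ i, d i • e' (τ i))).2
    have s1 := secondForm_sum (f := f₁) (ν := u) (x := x) (e := e ∘ σ) (κ := κ ∘ σ)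
      (fun i j => by simpa using heκ (σ i) (σ j)) c
    have s2 := secondForm_sum (f := f₂) (ν := u) (x := y) (e := e' ∘ τ) (κ := μ ∘ τ)
      (fun i j => by simpa using heμ (τ i) (τ j)) d
    rw [← s1, ← s2]
    rw [hcd', sub_self, norm_zero, hru, inner_neg_left, real_inner_smul_left, inner_sub_right,
      real_inner_comm, real_inner_comm _ u] at h
    simp only [secondForm, Function.comp_apply]
    have h' : 0 ≤ r * (-inner ℝ (fderiv ℝ (fderiv ℝ (localRep f₁ x)) (extChartAt (𝓡 n) x x)
        (∑ i, c i • e (σ i)) (∑ i, c i • e (σ i))) u +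
        inner ℝ (fderiv ℝ (fderiv ℝ (localRep f₂ y)) (extChartAt (𝓡 n) y y)
        (∑ i, d i • e' (τ i)) (∑ i, d i • e' (τ i))) u) := by linarith
    have := nonneg_of_mul_nonneg_right h' hr
    linarith

/-- Under the flow, the squared distance of a closest pair of points has nonnegative time
derivative. -/
theorem inner_velocity_nonneg_of_closest [IsManifold (𝓡 n) ∞ M₁] [IsManifold (𝓡 n) ∞ M₂]
    {D : Set (Fin n → ℝ)} {F : (Fin n → ℝ) → ℝ} {T : EReal}
    (hDneg : ∀ κ ∈ D, -κ ∈ D) (hDperm : ∀ σ : Equiv.Perm (Fin n), ∀ κ ∈ D, κ ∘ σ ∈ D)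
    (hF : IsOddMonotoneSymmetric D F)
    {X₁ ν₁ : M₁ → ℝ → EuclideanSpace ℝ (Fin (n + 1))}
    {X₂ ν₂ : M₂ → ℝ → EuclideanSpace ℝ (Fin (n + 1))}
    (h₁ : IsSolution D F T X₁ ν₁) (h₂ : IsSolution D F T X₂ ν₂) {t : ℝ} (ht : t ∈ timeInterval T)
    (hI : UniqueDiffWithinAt ℝ (timeInterval T) t) {x : M₁} {y : M₂}
    (hmin : ∀ x' y', ‖X₁ x t - X₂ y t‖ ^ 2 ≤ ‖X₁ x' t - X₂ y' t‖ ^ 2) :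
    0 ≤ inner ℝ (X₁ x t - X₂ y t)
      (derivWithin (X₁ x) (timeInterval T) t - derivWithin (X₂ y) (timeInterval T) t) := by
  by_cases h0 : X₁ x t - X₂ y t = 0
  -- Coincident points are harmless, so disjointness is not needed here.
  · rw [h0, inner_zero_left]
  have hr : 0 < ‖X₁ x t - X₂ y t‖ := norm_pos_iff.2 h0
  set r := ‖X₁ x t - X₂ y t‖ with hr_def
  set u := -(r⁻¹ • (X₁ x t - X₂ y t)) with hu_def
  have hru : X₁ x t - X₂ y t = -(r • u) := by
    rw [hu_def, smul_neg, neg_neg, smul_inv_smul₀ hr.ne']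
  have hu : ‖u‖ = 1 := by
    rw [hu_def, norm_neg, norm_smul, ← hr_def, norm_inv, Real.norm_of_nonneg hr.le,
      inv_mul_cancel₀ hr.ne']
  have hvar := variation_of_closest (h₁.contMDiff t ht) (h₂.contMDiff t ht) hmin
  have hu₁ : IsUnitNormal (fun z => X₁ z t) x u := by
    refine ⟨hu, fun v => ?_⟩
    -- Varying one point while the other stays fixed gives normality to each hypersurface
    -- separately.
    have := (hvar v 0).1
    rw [map_zero, sub_zero, real_inner_comm] at this
    rw [hu_def, inner_neg_right, real_inner_smul_right, this, mul_zero, neg_zero]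
  have hu₂ : IsUnitNormal (fun z => X₂ z t) y u := by
    refine ⟨hu, fun v => ?_⟩
    have := (hvar 0 v).1
    rw [map_zero, zero_sub, inner_neg_right, neg_eq_zero, real_inner_comm] at this
    rw [hu_def, inner_neg_right, real_inner_smul_right, this, mul_zero, neg_zero]
  obtain ⟨κ, hκD, hκ, hd₁⟩ := h₁.exists_curvatures hDneg hF.odd ht hu₁
  obtain ⟨μ, hμD, hμ, hd₂⟩ := h₂.exists_curvatures hDneg hF.odd ht hu₂
  have hle := sorted_curvatures_le_of_closest (h₁.contMDiff t ht) (h₂.contMDiff t ht) hmin hr hru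
    hu₁ hu₂ hκ hμ
  have hFle := hF.mono (hDperm _ μ hμD) (hDperm _ κ hκD) hle
  rw [hF.symm _ μ hμD, hF.symm _ κ hκD] at hFle
  rw [hd₁.derivWithin hI, hd₂.derivWithin hI, hru]
  have hval : inner ℝ (-(r • u)) (-(F κ • u) - -(F μ • u)) = r * (F κ - F μ) := by
    rw [neg_sub_neg, ← sub_smul, inner_neg_left, real_inner_smul_left, real_inner_smul_right,
      real_inner_self_eq_norm_sq, hu]
    ring
  rw [hval]
  exact mul_nonneg hr.le (sub_nonneg.2 hFle)

end TwoHypersurfaces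

/-! ### Evolution of the distance -/

theorem Icc_subset_timeInterval {T : EReal} {a b : ℝ} (ha : a ∈ timeInterval T)
    (hb : b ∈ timeInterval T) : Icc a b ⊆ timeInterval T := fun _ hs =>
  ⟨ha.1.trans hs.1, lt_of_le_of_lt (EReal.coe_le_coe_iff.2 hs.2) hb.2⟩

/-- For each pair of points at time `b` there is a pair at the earlier time `a` which is at most
as far apart. -/
theorem exists_norm_sub_le {n : ℕ} {M₁ M₂ : Type*}
    [TopologicalSpace M₁] [CompactSpace M₁]
    [ChartedSpace (EuclideanSpace ℝ (Fin n)) M₁] [IsManifold (𝓡 n) ∞ M₁]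
    [TopologicalSpace M₂] [CompactSpace M₂]
    [ChartedSpace (EuclideanSpace ℝ (Fin n)) M₂] [IsManifold (𝓡 n) ∞ M₂]
    {D : Set (Fin n → ℝ)} {F : (Fin n → ℝ) → ℝ} {T : EReal}
    (hDneg : ∀ κ ∈ D, -κ ∈ D) (hDperm : ∀ σ : Equiv.Perm (Fin n), ∀ κ ∈ D, κ ∘ σ ∈ D)
    (hF : IsOddMonotoneSymmetric D F)
    {X₁ ν₁ : M₁ → ℝ → EuclideanSpace ℝ (Fin (n + 1))}
    {X₂ ν₂ : M₂ → ℝ → EuclideanSpace ℝ (Fin (n + 1))}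
    (h₁ : IsSolution D F T X₁ ν₁) (h₂ : IsSolution D F T X₂ ν₂) {a b : ℝ}
    (ha : a ∈ timeInterval T) (hb : b ∈ timeInterval T) (hab : a ≤ b) (x : M₁) (y : M₂) :
    ∃ x' y', ‖X₁ x' a - X₂ y' a‖ ≤ ‖X₁ x b - X₂ y b‖ := by
  -- A degenerate interval would not give unique differentiability within `Icc a b`.
  rcases hab.eq_or_lt with rfl | hlt
  · exact ⟨x, y, le_rfl⟩
  have hsub := Icc_subset_timeInterval ha hb
  have hI : ∀ t ∈ Icc a b, UniqueDiffWithinAt ℝ (timeInterval T) t := fun t ht =>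
    (uniqueDiffOn_Icc hlt t ht).mono hsub
  have hpr₁ : ContinuousOn (fun z : (M₁ × M₂) × ℝ => (z.1.1, z.2)) (univ ×ˢ Icc a b) := by
    fun_prop
  have hpr₂ : ContinuousOn (fun z : (M₁ × M₂) × ℝ => (z.1.2, z.2)) (univ ×ˢ Icc a b) := by
    fun_prop
  have hm₁ : MapsTo (fun z : (M₁ × M₂) × ℝ => (z.1.1, z.2)) (univ ×ˢ Icc a b)
      (univ ×ˢ timeInterval T) := fun z hz => ⟨mem_univ _, hsub hz.2⟩
  have hm₂ : MapsTo (fun z : (M₁ × M₂) × ℝ => (z.1.2, z.2)) (univ ×ˢ Icc a b)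
      (univ ×ˢ timeInterval T) := fun z hz => ⟨mem_univ _, hsub hz.2⟩
  have hX := (h₁.continuousOn.comp hpr₁ hm₁).sub (h₂.continuousOn.comp hpr₂ hm₂)
  have hV := (h₁.continuousOn_velocity.comp hpr₁ hm₁).sub
    (h₂.continuousOn_velocity.comp hpr₂ hm₂)
  obtain ⟨⟨x', y'⟩, h⟩ := exists_le_of_deriv_nonneg_at_min (K := M₁ × M₂)
    (q := fun p t => ‖X₁ p.1 t - X₂ p.2 t‖ ^ 2)
    (q' := fun p t => 2 * inner ℝ (X₁ p.1 t - X₂ p.2 t)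
      (derivWithin (X₁ p.1) (timeInterval T) t - derivWithin (X₂ p.2) (timeInterval T) t))
    hab (hX.norm.pow 2) (continuousOn_const.mul (hX.inner hV))
    (fun p t ht => by
      obtain ⟨κ, -, -, hd₁⟩ := h₁.flow t (hsub ht) p.1
      obtain ⟨μ, -, -, hd₂⟩ := h₂.flow t (hsub ht) p.2
      exact ((hd₁.differentiableWithinAt.hasDerivWithinAt.mono hsub).sub
        (hd₂.differentiableWithinAt.hasDerivWithinAt.mono hsub)).norm_sq)
    (fun t ht p hp => mul_nonneg zero_le_two
      (inner_velocity_nonneg_of_closest hDneg hDperm hF h₁ h₂ (hsub ht) (hI t ht)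
        fun x' y' => hp (x', y')))
    (x, y)
  exact ⟨x', y', le_of_sq_le_sq h (norm_nonneg _)⟩

end CurvatureFlow

theorem mainTheorem3 {n : ℕ}
    (Γ : Set (Fin n → ℝ)) (hΓ : CurvatureFlow.IsSymmetricCone Γ)
    (F : (Fin n → ℝ) → ℝ)
    (hF : CurvatureFlow.IsOddMonotoneSymmetric (Γ ∪ {κ | -κ ∈ Γ}) F)
    {M₁ : Type*} [TopologicalSpace M₁] [T2Space M₁] [CompactSpace M₁]
    [ChartedSpace (EuclideanSpace ℝ (Fin n)) M₁] [IsManifold (𝓡 n) ∞ M₁]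
    {M₂ : Type*} [TopologicalSpace M₂] [T2Space M₂] [CompactSpace M₂]
    [ChartedSpace (EuclideanSpace ℝ (Fin n)) M₂] [IsManifold (𝓡 n) ∞ M₂]
    (T : EReal)
    (X₁ ν₁ : M₁ → ℝ → EuclideanSpace ℝ (Fin (n + 1)))
    (X₂ ν₂ : M₂ → ℝ → EuclideanSpace ℝ (Fin (n + 1)))
    (h₁ : CurvatureFlow.IsSolution (Γ ∪ {κ | -κ ∈ Γ}) F T X₁ ν₁)
    (h₂ : CurvatureFlow.IsSolution (Γ ∪ {κ | -κ ∈ Γ}) F T X₂ ν₂)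
    (hdisj : Disjoint (Set.range fun x => X₁ x 0) (Set.range fun y => X₂ y 0)) :
    MonotoneOn
      (fun t => CurvatureFlow.setDist (Set.range fun x => X₁ x t) (Set.range fun y => X₂ y t))
      (CurvatureFlow.timeInterval T) ∧
    ∀ t ∈ CurvatureFlow.timeInterval T,
      Disjoint (Set.range fun x => X₁ x t) (Set.range fun y => X₂ y t) := by
  have hDneg : ∀ κ ∈ Γ ∪ {κ | -κ ∈ Γ}, -κ ∈ Γ ∪ {κ | -κ ∈ Γ} := by
    rintro κ (h | h)
    · exact Or.inr (by simpa using h)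
    · exact Or.inl h
  have hDperm : ∀ σ : Equiv.Perm (Fin n), ∀ κ ∈ Γ ∪ {κ | -κ ∈ Γ}, κ ∘ σ ∈ Γ ∪ {κ | -κ ∈ Γ} := by
    rintro σ κ (h | h)
    · exact Or.inl (hΓ.perm_mem σ κ h)
    · exact Or.inr (hΓ.perm_mem σ (-κ) h)
  have key := fun {a b : ℝ} => CurvatureFlow.exists_norm_sub_le (a := a) (b := b) hDneg hDperm hF
    h₁ h₂
  refine ⟨fun a ha b hb hab => ?_, fun t ht => ?_⟩
  · by_cases hne : Nonempty M₁ ∧ Nonempty M₂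
    · obtain ⟨⟨x₀⟩, ⟨y₀⟩⟩ := hne
      refine le_csInf ⟨_, Set.mem_image2_of_mem (Set.mem_range_self x₀) (Set.mem_range_self y₀)⟩ ?_
      rintro _ ⟨_, ⟨x, rfl⟩, _, ⟨y, rfl⟩, rfl⟩
      obtain ⟨x', y', h⟩ := key ha hb hab x y
      rw [← dist_eq_norm, ← dist_eq_norm] at h
      refine (csInf_le ⟨0, ?_⟩ (Set.mem_image2_of_mem (Set.mem_range_self x') (Set.mem_range_self y'))).trans h
      rintro _ ⟨_, -, _, -, rfl⟩
      exact dist_nonneg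
    · rw [not_and_or, not_nonempty_iff, not_nonempty_iff] at hne
      -- With an empty factor, `setDist` is the infimum of the empty set, the constant 0.
      rcases hne with h | h <;> simp [CurvatureFlow.setDist, Set.range_eq_empty]
  · rw [Set.disjoint_left]
    rintro _ ⟨x, rfl⟩ ⟨y, hxy⟩
    have h0 : (0 : ℝ) ∈ CurvatureFlow.timeInterval T :=
      ⟨le_rfl, lt_of_le_of_lt (EReal.coe_le_coe_iff.2 ht.1) ht.2⟩
    -- An intersection at time t yields a pair at distance 0 at time 0.
    obtain ⟨x', y', h⟩ := key h0 ht ht.1 x y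
    rw [← show X₂ y t = X₁ x t from hxy, sub_self, norm_zero] at h
    exact Set.disjoint_left.1 hdisj (Set.mem_range_self x')
      ⟨y', (sub_eq_zero.1 (norm_le_zero_iff.1 h)).symm⟩
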